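/- Let $K=\mathbf F_q$ be a finite field, $X$ a separated $K$-scheme of finite type, $f:X\to\mathbf A^1$ a morphism over $K$, and $\chi,\chi':(K,+)\to\mathbf C^*$ two characters. For $n\ge 0$ let $S^n(X)=X^n/\mathfrak S_n$ be the symmetric power (the quotient taken in locally ringed spaces over $K$; for quasi-projective $X$ this is the usual scheme), and $f^{(n)}:S^n(X)\to\mathbf A^1$, $f^{(n)}[x_1,\dots,x_n]=f(x_1)+\dots+f(x_n)$. For $x\in S^n(X)(K)$ let $T_xS^n(X)$ be the set of points $\varphi\in \mathcal L_1(S^n(X))(K)=S^n(X)(K[u]/u^2)$ reducing to $x$ modulo $u$, and let $df^{(n)}_x(v)\in K$ be the coefficient of $u$ in $f^{(n)}_1(\varphi)\in K[u]/u^2$, for $v\in T_xS^n(X)$ given by the arc $\varphi$, where $f_1^{(n)}$ is the map induced by $f^{(n)}$ on $K[u]/u^2$-points. Let $\chi_1:K[u]/u^2\to\mathbf C^*$ be the additive character $\chi_1(a+bu)=\chi(a)\chi'(b)$. Let $t\in\mathbf C$, $t\ne0$, be such that the series $$\zeta_\chi((X,f),t)=\sum_{n\ge0}\ \sum_{x\in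 S^n(X)(K)}\chi(f^{(n)}(x))\,t^n$$ converges absolutely (as a sum over all pairs $(n,x)$) and has a nonzero value $\zeta_\chi$. Let $\rho$ be the complex-valued distribution $$P_{n,x}=\frac{\chi(f^{(n)}(x))\,t^n}{\zeta_\chi((X,f),t)}\qquad(n\ge0,\ x\in S^n(X)(K)),$$ regarded as a diagonal operator. For a choice $v=(v_{n,x})$ of one tangent vector $v_{n,x}\in T_xS^n(X)$ for each $(n,x)$, let $h(v)$ be the increment $h_{n,x}(v)=\chi_1(f^{(n)}_1(\varphi))\,t^n$, where $\varphi$ is the arc given by $x$ and $v_{n,x}$. Let $$g_{v,w}=\tfrac12\,\mathrm{Tr}\big(h(v)\rho^{-1}h(w)\big)=\tfrac12\sum_{n,x}P_{n,x}^{-1}\,h_{n,x}(v)\,h_{n,x}(w)$$ be the symmetric bilinear form in the increments with quadratic form $\tfrac12\mathrm{Tr}(h\rho^{-1}h)$. Then, for all such $v,w$: 1. The series for $g_{v,w}$ and the series below converge absolutely, and $$g_{v,w}=\frac{\zeta_\chi((X,f),t)}2\sum_{n,x}\chi(f^{(n)}(x))\,\chi'(df^{(n)}_x(v))\,\chi'(df^{(n)}_x(w))\,t^n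 .$$ 2. The tensor $g$ is the quadratic term of the Kullback--Leibler divergence $KL(P\|Q)=\sum_i P_i\log(P_i/Q_i)$ (principal branch) at $\rho$: the traces of $h(v),h(w)$ converge absolutely and, for $(a,b)\in\mathbf C^2$ near $0$, the series for $KL(\rho+a\,h(v)+b\,h(w)\,\|\,\rho)$ converges absolutely, and as $(a,b)\to(0,0)$ $$KL\big(\rho+a\,h(v)+b\,h(w)\,\|\,\rho\big)=a\,\mathrm{Tr}\,h(v)+b\,\mathrm{Tr}\,h(w)+a^2g_{v,v}+2ab\,g_{v,w}+b^2g_{w,w}+O\big(\|(a,b)\|^3\big).$$ -/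

import Mathlib

open CategoryTheory CategoryTheory.Limits AlgebraicGeometry Filter Topology Asymptotics

universe u

noncomputable section

namespace ArcFisher

/-! ### Schemes and locally ringed spaces over a field -/

section Geometry

variable (K : Type u) [Field K]

/-- The base `Spec K` as a scheme. -/
abbrev base : Scheme.{u} := Spec (CommRingCat.of K)

/-- The category of locally ringed spaces over `Spec K`. -/
abbrev LRSOver := Over (Scheme.forgetToLocallyRingedSpace.obj (base K))

/-- A `K`-scheme, viewed as a locally ringed space over `Spec K` (a fully faithful functor). -/
abbrev toLRS : Over (base K) ⥤ LRSOver K := Over.post Scheme.forgetToLocallyRingedSpace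

/-- The affine line over `K`. -/
def affineLine : Over (base K) :=
  Over.mk (AffineSpace.over (n := PUnit.{u + 1}) (base K)).hom

/-- The `K`-scheme `Spec A`, for a `K`-algebra `A`. -/
abbrev specOver (A : Type u) [CommRing A] [Algebra K A] : Over (base K) :=
  Over.mk (Spec.map (CommRingCat.ofHom (algebraMap K A)))

variable {K}

/-- `Y(A)`: the `A`-valued points over `K` of a locally ringed space `Y` over `K`. -/
def Points (A : Type u) [CommRing A] [Algebra K A] (Y : LRSOver K) : Type u :=
  (toLRS K).obj (specOver K A) ⟶ Y

/-- The map `Y(A) → Y(B)` induced by a homomorphism of `K`-algebras `A → B`. -/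
def Points.map {A B : Type u} [CommRing A] [Algebra K A] [CommRing B] [Algebra K B]
    {Y : LRSOver K} (φ : A →ₐ[K] B) (y : Points A Y) : Points B Y :=
  (toLRS K).map (Over.homMk (Spec.map (CommRingCat.ofHom φ.toRingHom)) (by
    simp only [specOver, Over.mk_hom, ← Spec.map_comp, ← CommRingCat.ofHom_comp]
    congr 2
    exact φ.comp_algebraMap) : specOver K B ⟶ specOver K A) ≫ y

/-- The global function on `X` given by a morphism `X ⟶ 𝔸¹`: the pullback of the coordinate. -/
def function {X : Over (base K)} (g : X ⟶ affineLine K) : Γ(X.left, ⊤) :=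
  (show X.left ⟶ AffineSpace PUnit.{u + 1} (base K) from g.left).appTop
    (AffineSpace.coord (base K) PUnit.unit)

/-- The morphism `X ⟶ 𝔸¹` given by a global function on `X`. -/
def ofFunction {X : Over (base K)} (s : Γ(X.left, ⊤)) : X ⟶ affineLine K :=
  Over.homMk (AffineSpace.homOfVector X.hom fun _ : PUnit.{u + 1} => s)
    (AffineSpace.homOfVector_over _ _)

lemma function_ofFunction {X : Over (base K)} (s : Γ(X.left, ⊤)) :
    function (ofFunction s) = s :=
  AffineSpace.homOfVector_appTop_coord X.hom (fun _ : PUnit.{u + 1} => s) PUnit.unit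

lemma function_comp {X Y : Over (base K)} (k : X ⟶ Y) (g : Y ⟶ affineLine K) :
    function (k ≫ g) = k.left.appTop (function g) :=
  rfl

lemma function_injective {X : Over (base K)} {g g' : X ⟶ affineLine K}
    (h : function g = function g') : g = g' :=
  Over.OverMorphism.ext
    (AffineSpace.hom_ext ((Over.w g).trans (Over.w g').symm) fun _ => h)

lemma comp_ofFunction {X Y : Over (base K)} (k : X ⟶ Y) (s : Γ(Y.left, ⊤)) :
    k ≫ ofFunction s = ofFunction (k.left.appTop s) :=
  function_injective (by rw [function_comp, function_ofFunction, function_ofFunction])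

/-- The value `F(y) ∈ 𝔸¹(A) = A` of `F : Y ⟶ 𝔸¹` at a point `y ∈ Y(A)`: the pullback to `Spec A`
of the coordinate function on `𝔸¹`. -/
def evalAt {A : Type u} [CommRing A] [Algebra K A] {Y : LRSOver K}
    (F : Y ⟶ (toLRS K).obj (affineLine K)) (y : Points A Y) : A :=
  (Scheme.ΓSpecIso (CommRingCat.of A)).hom
    (function ((toLRS K).preimage (y ≫ F) : specOver K A ⟶ affineLine K))

/-! ### Symmetric powers -/

/-- The `n`-fold fibre power `Xⁿ` over `K`. -/
def power (X : Over (base K)) (n : ℕ) : Over (base K) := ∏ᶜ fun _ : Fin n => X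

/-- The projections `Xⁿ ⟶ X`. -/
def power.proj (X : Over (base K)) (n : ℕ) (i : Fin n) : power X n ⟶ X :=
  Pi.π (fun _ : Fin n => X) i

/-- The automorphism `(xᵢ) ↦ (x_{σ i})` of `Xⁿ`. -/
def power.perm (X : Over (base K)) (n : ℕ) (σ : Equiv.Perm (Fin n)) : power X n ⟶ power X n :=
  Pi.lift fun i => power.proj X n (σ i)

/-- The morphism `(xᵢ) ↦ ∑ f(xᵢ)` from `Xⁿ` to `𝔸¹`. -/
def power.sum {X : Over (base K)} (f : X ⟶ affineLine K) (n : ℕ) : power X n ⟶ affineLine K :=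
  ofFunction (∑ i : Fin n, function (power.proj X n i ≫ f))

lemma power.perm_proj (X : Over (base K)) (n : ℕ) (σ : Equiv.Perm (Fin n)) (i : Fin n) :
    power.perm X n σ ≫ power.proj X n i = power.proj X n (σ i) :=
  Pi.lift_π _ _

lemma power.perm_sum {X : Over (base K)} (f : X ⟶ affineLine K) (n : ℕ)
    (σ : Equiv.Perm (Fin n)) : power.perm X n σ ≫ power.sum f n = power.sum f n := by
  rw [power.sum, comp_ofFunction]
  congr 1
  rw [map_sum]
  refine Fintype.sum_equiv σ _ _ fun i => ?_
  rw [← power.perm_proj X n σ i, Category.assoc, function_comp, function_comp, function_comp]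

instance hasColimitsOfShape_perm (n : ℕ) :
    HasColimitsOfShape (WalkingParallelFamily (Equiv.Perm (Fin n))) LocallyRingedSpace.{u} :=
  have : HasColimitsOfSize.{0, 0} LocallyRingedSpace.{u} :=
    hasColimitsOfSizeShrink.{0, 0, u, u} _
  inferInstance

/-- The diagram of the action of the symmetric group on `Xⁿ`, in locally ringed spaces. -/
abbrev permFamily (X : Over (base K)) (n : ℕ) (σ : Equiv.Perm (Fin n)) :
    ((toLRS K).obj (power X n)).left ⟶ ((toLRS K).obj (power X n)).left :=
  ((toLRS K).map (power.perm X n σ)).left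

/-- The symmetric power `Sⁿ(X) = Xⁿ / 𝔖ₙ`: the quotient of `Xⁿ` by the symmetric group, i.e. the
topological quotient with the sheaf of invariant functions. It is formed in locally ringed spaces
over `K`, where it always exists; when every finite set of points of `X` lies in an affine open
set (for instance when `X` is quasi-projective) it is a scheme. -/
def symPower (X : Over (base K)) (n : ℕ) : LRSOver K :=
  Over.mk (wideCoequalizer.desc (f := permFamily X n) ((toLRS K).obj (power X n)).hom
    (fun σ τ => by rw [Over.w, Over.w]))

/-- The morphism `f⁽ⁿ⁾ : Sⁿ(X) ⟶ 𝔸¹`, `[x₁, …, xₙ] ↦ f(x₁) + ⋯ + f(xₙ)`. -/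
def symPower.map {X : Over (base K)} (f : X ⟶ affineLine K) (n : ℕ) :
    symPower X n ⟶ (toLRS K).obj (affineLine K) :=
  Over.homMk
    (wideCoequalizer.desc (f := permFamily X n) ((toLRS K).map (power.sum f n)).left
      (fun σ τ => by
        rw [← Over.comp_left, ← Over.comp_left, ← Functor.map_comp, ← Functor.map_comp,
          power.perm_sum, power.perm_sum]))
    (by
      apply wideCoequalizer.hom_ext
      simp only [symPower, Over.mk_hom]
      rw [wideCoequalizer.π_desc_assoc, wideCoequalizer.π_desc, Over.w])

/-! ### The first truncated arc space and differentials -/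

/-- `ℒ₁(Y)(K) = Y(K[u]/u²)`: the `K`-points of the first truncated arc space of `Y`. -/
abbrev ArcPoints (Y : LRSOver K) : Type u := Points (DualNumber K) Y

/-- The tangent space of `Y` at a `K`-point `y`: the truncated arcs with origin `y`. -/
def TangentAt {Y : LRSOver K} (y : Points K Y) : Type u :=
  {φ : ArcPoints Y // φ.map (TrivSqZeroExt.fstHom K K K) = y}

/-- The differential `dF_y(v) ∈ T_{F(y)} 𝔸¹ = K` of `F : Y ⟶ 𝔸¹`: the coefficient of `u` in the
image of the arc `v` under the induced map `ℒ₁(Y) → ℒ₁(𝔸¹)`. -/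
def differential {Y : LRSOver K} (F : Y ⟶ (toLRS K).obj (affineLine K)) {y : Points K Y}
    (v : TangentAt y) : K :=
  (evalAt F v.1).snd

/-! ### Characters and zeta functions -/

/-- The character `a + b u ↦ χ(a) χ'(b)` of the additive group `K[u]/u²` given by a pair of
characters of `K`. -/
def pairChar (χ χ' : AddChar K ℂ) : AddChar (DualNumber K) ℂ where
  toFun z := χ z.fst * χ' z.snd
  map_zero_eq_one' := by simp
  map_add_eq_mul' z w := by
    simp only [TrivSqZeroExt.fst_add, TrivSqZeroExt.snd_add, AddChar.map_add_eq_mul]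
    ring

/-- The index set of the distribution: pairs `(n, x)` with `x ∈ Sⁿ(X)(K)`. -/
abbrev Index (X : Over (base K)) : Type u := Σ n : ℕ, Points K (symPower X n)

/-- The value `f⁽ⁿ⁾(x) ∈ K`. -/
def value {X : Over (base K)} (f : X ⟶ affineLine K) (p : Index X) : K :=
  evalAt (symPower.map f p.1) p.2

/-- A choice of tangent vectors `v_x ∈ T_x Sⁿ(X)`, one for each `n` and each `x ∈ Sⁿ(X)(K)`. -/
abbrev TangentField (X : Over (base K)) : Type u := ∀ p : Index X, TangentAt p.2

/-- The motivic measure `μ_χ(Y, F) = ∑_{y ∈ Y(K)} χ(F(y))`. -/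
def motivicMeasure (χ : AddChar K ℂ) {Y : LRSOver K} (F : Y ⟶ (toLRS K).obj (affineLine K)) : ℂ :=
  ∑' y : Points K Y, χ (evalAt F y)

/-- The zeta function `ζ_χ((X, f), t) = ∑ₙ μ_χ(Sⁿ(X), f⁽ⁿ⁾) tⁿ`. -/
def zeta (χ : AddChar K ℂ) {X : Over (base K)} (f : X ⟶ affineLine K) (t : ℂ) : ℂ :=
  ∑' n : ℕ, motivicMeasure χ (symPower.map f n) * t ^ n

/-- The distribution `P_{n,x} = χ(f⁽ⁿ⁾(x)) tⁿ / ζ_χ((X, f), t)`. -/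
def zetaDist (χ : AddChar K ℂ) {X : Over (base K)} (f : X ⟶ affineLine K) (t : ℂ) (p : Index X) : ℂ :=
  χ (value f p) * t ^ p.1 / zeta χ f t

/-- The increment `h_{n,φ} = χ₁(f₁⁽ⁿ⁾(φ)) tⁿ`, for `φ ∈ ℒ₁(Sⁿ(X))(K)` and a character `χ₁` of
`K[u]/u²`. -/
def increment (χ₁ : AddChar (DualNumber K) ℂ) {X : Over (base K)} (f : X ⟶ affineLine K) (t : ℂ)
    (n : ℕ) (φ : ArcPoints (symPower X n)) : ℂ :=
  χ₁ (evalAt (symPower.map f n) φ) * t ^ n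

/-- The increment `h_{n,x}(v) = h_{n,φ}`, where `φ` is the arc given by `x` and the tangent vector
`v_x`. -/
def incrementAlong (χ₁ : AddChar (DualNumber K) ℂ) {X : Over (base K)} (f : X ⟶ affineLine K)
    (t : ℂ) (v : TangentField X) (p : Index X) : ℂ :=
  increment χ₁ f t p.1 (v p).1

end Geometry

/-! ### Complex-valued information theory (diagonal density matrices) -/

section Information

variable {ι : Type u}

/-- The trace of the diagonal operator with entries `a`. -/
def diagTrace (a : ι → ℂ) : ℂ := ∑' i, a i

/-- The summands `Pᵢ log (Pᵢ / Qᵢ)` of the Kullback--Leibler divergence, with the principal branch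
of the logarithm. -/
def klTerm (P Q : ι → ℂ) (i : ι) : ℂ := P i * Complex.log (P i / Q i)

/-- The Kullback--Leibler divergence of complex-valued distributions. -/
def klDiv (P Q : ι → ℂ) : ℂ := ∑' i, klTerm P Q i

/-- The Fisher--Rao tensor at `ρ`, evaluated at two increments: the symmetric bilinear form
`½ Tr(h ρ⁻¹ k)` with associated quadratic form `½ Tr(h ρ⁻¹ h)`, for diagonal `ρ`, `h`, `k`. -/
def fisherRao (ρ h k : ι → ℂ) : ℂ := 1 / 2 * diagTrace fun i => h i * (ρ i)⁻¹ * k i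

end Information

end ArcFisher

end

/-! Everything follows from one pointwise relation: `h v p` equals `ζ · χ'(df(v)) · ρ p`. It holds
because an arc and its origin have the same value modulo `u`. Characters of a finite group have
modulus one, so `‖h v p‖ = ‖ζ‖ ‖ρ p‖`, and each series is dominated by the absolutely convergent
`ρ`. Substituting the relation into `h ρ⁻¹ h` gives the closed formula. For the divergence, `(a h +
b k) / ρ` is `O(‖(a, b)‖)` uniformly in the index, so the scalar expansion `(1 + s) log (1 + s) = s
+ s²/2 + O(s³)` may be summed with weights `‖ρ p‖` (`norm_klDiv_add_sub_le`, `klDiv_expansion`). -/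

namespace ArcFisher

/-! ### Values of functions at arcs and at their origins. -/

section Evaluation

variable {K : Type u} [Field K]

/-- Evaluation of a function on points is natural in the algebra of coefficients. -/
lemma evalAt_map {A B : Type u} [CommRing A] [Algebra K A] [CommRing B] [Algebra K B]
    {Y : LRSOver K} (F : Y ⟶ (toLRS K).obj (affineLine K)) (ψ : A →ₐ[K] B) (y : Points A Y) :
    evalAt F (y.map ψ) = ψ (evalAt F y) := by
  let k : specOver K B ⟶ specOver K A :=
    Over.homMk (Spec.map (CommRingCat.ofHom ψ.toRingHom)) (by
      simp only [specOver, Over.mk_hom, ← Spec.map_comp, ← CommRingCat.ofHom_comp]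
      congr 2
      exact ψ.comp_algebraMap)
  let y' : (toLRS K).obj (specOver K A) ⟶ Y := y
  -- `toLRS K` is faithful, so this identity of scheme morphisms can be checked in locally ringed
  -- spaces.
  have hpre : (toLRS K).preimage (((toLRS K).map k ≫ y') ≫ F) =
      k ≫ (toLRS K).preimage (y' ≫ F) :=
    (toLRS K).map_injective (by
      rw [Functor.map_preimage, Functor.map_comp, Functor.map_preimage, Category.assoc])
  change (Scheme.ΓSpecIso (CommRingCat.of B)).hom
    (function ((toLRS K).preimage (((toLRS K).map k ≫ y') ≫ F))) = _
  rw [hpre, function_comp]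
  exact ConcreteCategory.congr_hom (Scheme.ΓSpecIso_naturality (CommRingCat.ofHom ψ.toRingHom)) _

/-- Naturality of evaluation along `u ↦ 0` identifies the constant term at the arc with the value at
its origin. -/
lemma incrementAlong_pairChar (χ χ' : AddChar K ℂ) {X : Over (base K)} (f : X ⟶ affineLine K)
    (t : ℂ) (v : TangentField X) (p : Index X) :
    incrementAlong (pairChar χ χ') f t v p =
      χ (value f p) * χ' (differential (symPower.map f p.1) (v p)) * t ^ p.1 := by
  have hfst : (evalAt (symPower.map f p.1) (v p).1).fst = value f p := by
    have := evalAt_map (symPower.map f p.1) (TrivSqZeroExt.fstHom K K K) (v p).1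
    rw [(v p).2] at this
    exact this.symm
  change χ (evalAt (symPower.map f p.1) (v p).1).fst * _ * _ = _
  rw [hfst]
  rfl

end Evaluation

/-! ### Second order expansion of the divergence. -/

section Divergence

variable {ι : Type u}

lemma norm_one_add_mul_log_sub_le {s : ℂ} (hs : ‖s‖ ≤ 1 / 2) :
    ‖(1 + s) * Complex.log (1 + s) - (s + s ^ 2 / 2)‖ ≤ 2 * ‖s‖ ^ 3 := by
  have hlog : ‖Complex.log (1 + s) - (s - s ^ 2 / 2)‖ ≤ ‖s‖ ^ 3 * (2 / 3) := by
    have h := Complex.norm_log_sub_logTaylor_le 2 (z := s) (by linarith)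
    have hT : Complex.logTaylor 3 s = s - s ^ 2 / 2 := by
      simp [Complex.logTaylor, Finset.sum_range_succ]
      ring
    rw [show (2 + 1 : ℕ) = 3 from rfl, hT] at h
    refine h.trans ?_
    have hinv : (1 - ‖s‖)⁻¹ ≤ 2 := by
      rw [inv_le_comm₀ (by linarith) two_pos]
      linarith
    have := mul_le_mul_of_nonneg_left hinv (pow_nonneg (norm_nonneg s) 3)
    push_cast
    linarith
  -- Since `(1 + s)(s - s²/2) = s + s²/2 - s³/2`, the error is at most `(3/2 · 2/3 + 1/2) ‖s‖³`.
  have hdecomp : (1 + s) * Complex.log (1 + s) - (s + s ^ 2 / 2) =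
      (1 + s) * (Complex.log (1 + s) - (s - s ^ 2 / 2)) - s ^ 3 / 2 := by ring
  have hone : ‖1 + s‖ ≤ 3 / 2 := (norm_add_le _ _).trans (by rw [norm_one]; linarith)
  rw [hdecomp]
  calc _ ≤ ‖(1 + s) * (Complex.log (1 + s) - (s - s ^ 2 / 2))‖ + ‖s ^ 3 / 2‖ := norm_sub_le _ _
    _ ≤ 3 / 2 * (‖s‖ ^ 3 * (2 / 3)) + ‖s‖ ^ 3 / 2 := by
      rw [norm_mul, norm_div, norm_pow, Complex.norm_ofNat]
      gcongr
    _ ≤ 2 * ‖s‖ ^ 3 := by linarith [pow_nonneg (norm_nonneg s) 3]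

/-- Scalar estimate at `s = e i / ρ i`, multiplied by `ρ i`. A relative bound on `e` leaves an error
proportional to `‖ρ i‖`, hence summable. -/
lemma norm_klTerm_add_sub_le {ρ e : ι → ℂ} {r : ℝ} {i : ι} (hρ : ρ i ≠ 0) (hr : r ≤ 1 / 2)
    (he : ‖e i‖ ≤ r * ‖ρ i‖) :
    ‖klTerm (fun j => ρ j + e j) ρ i - (e i + 1 / 2 * (e i * (ρ i)⁻¹ * e i))‖ ≤
      2 * r ^ 3 * ‖ρ i‖ := by
  have hs : ‖e i / ρ i‖ ≤ r := by
    rw [norm_div]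
    exact div_le_of_le_mul₀ (norm_nonneg _)
      (nonneg_of_mul_nonneg_left ((norm_nonneg _).trans he) (norm_pos_iff.2 hρ)) he
  have hq : (ρ i + e i) / ρ i = 1 + e i / ρ i := by rw [add_div, div_self hρ]
  have hdecomp : klTerm (fun j => ρ j + e j) ρ i - (e i + 1 / 2 * (e i * (ρ i)⁻¹ * e i)) =
      ρ i * ((1 + e i / ρ i) * Complex.log (1 + e i / ρ i) -
        (e i / ρ i + (e i / ρ i) ^ 2 / 2)) := by
    simp only [klTerm, hq]
    field_simp
  rw [hdecomp, norm_mul, mul_comm]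
  gcongr
  exact (norm_one_add_mul_log_sub_le (hs.trans hr)).trans (by gcongr)

lemma summable_of_norm_le_mul {ρ e : ι → ℂ} {r : ℝ} (hρ : Summable ρ)
    (he : ∀ i, ‖e i‖ ≤ r * ‖ρ i‖) : Summable e :=
  .of_norm_bounded (hρ.norm.mul_left r) he

lemma summable_mul_inv_mul {ρ h k : ι → ℂ} {r s : ℝ} (hρ : Summable ρ)
    (hh : ∀ i, ‖h i‖ ≤ r * ‖ρ i‖) (hk : ∀ i, ‖k i‖ ≤ s * ‖ρ i‖) :
    Summable fun i => h i * (ρ i)⁻¹ * k i := by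
  refine summable_of_norm_le_mul (r := r * s) hρ fun i => ?_
  rw [norm_mul, norm_mul, norm_inv]
  rcases eq_or_ne (ρ i) 0 with h0 | h0
  -- Here `(ρ i)⁻¹ = 0` by convention, so the term vanishes.
  · simp [h0]
  have hpos := norm_pos_iff.2 h0
  calc ‖h i‖ * ‖ρ i‖⁻¹ * ‖k i‖ ≤ (r * ‖ρ i‖) * ‖ρ i‖⁻¹ * (s * ‖ρ i‖) :=
        mul_le_mul (mul_le_mul_of_nonneg_right (hh i) (by positivity)) (hk i) (norm_nonneg _)
          (mul_nonneg ((norm_nonneg _).trans (hh i)) (by positivity))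
    _ = r * s * ‖ρ i‖ := by field_simp

lemma summable_klTerm_add {ρ e : ι → ℂ} {r : ℝ} (hsum : Summable ρ) (hρ : ∀ i, ρ i ≠ 0)
    (hr : r ≤ 1 / 2) (he : ∀ i, ‖e i‖ ≤ r * ‖ρ i‖) :
    Summable (klTerm (fun i => ρ i + e i) ρ) := by
  have hrem : Summable fun i => klTerm (fun j => ρ j + e j) ρ i -
      (e i + 1 / 2 * (e i * (ρ i)⁻¹ * e i)) :=
    summable_of_norm_le_mul hsum fun i => norm_klTerm_add_sub_le (hρ i) hr (he i)
  exact (hrem.add ((summable_of_norm_le_mul hsum he).add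
    ((summable_mul_inv_mul hsum he he).mul_left (1 / 2)))).congr fun i => (sub_add_cancel _ _)

/-- The second order expansion of the divergence `KL(ρ + e ‖ ρ)`. -/
lemma norm_klDiv_add_sub_le {ρ e : ι → ℂ} {r : ℝ} (hsum : Summable ρ) (hρ : ∀ i, ρ i ≠ 0)
    (hr : r ≤ 1 / 2) (he : ∀ i, ‖e i‖ ≤ r * ‖ρ i‖) :
    ‖klDiv (fun i => ρ i + e i) ρ - diagTrace e - fisherRao ρ e e‖ ≤
      2 * r ^ 3 * ∑' i, ‖ρ i‖ := by
  have hE := summable_of_norm_le_mul hsum he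
  have hQ := (summable_mul_inv_mul hsum he he).mul_left (1 / 2)
  have heq : klDiv (fun i => ρ i + e i) ρ - diagTrace e - fisherRao ρ e e =
      ∑' i, (klTerm (fun j => ρ j + e j) ρ i - (e i + 1 / 2 * (e i * (ρ i)⁻¹ * e i))) := by
    rw [(summable_klTerm_add hsum hρ hr he).tsum_sub (hE.add hQ), hE.tsum_add hQ, tsum_mul_left]
    simp only [klDiv, diagTrace, fisherRao]
    ring
  rw [heq, ← tsum_mul_left]
  exact tsum_of_norm_bounded (hsum.norm.mul_left _).hasSum
    fun i => norm_klTerm_add_sub_le (hρ i) hr (he i)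

lemma diagTrace_add_mul {h k : ι → ℂ} (hh : Summable h) (hk : Summable k) (a b : ℂ) :
    diagTrace (fun i => a * h i + b * k i) = a * diagTrace h + b * diagTrace k := by
  simp only [diagTrace]
  rw [(hh.mul_left a).tsum_add (hk.mul_left b), tsum_mul_left, tsum_mul_left]

lemma fisherRao_add_mul {ρ h k : ι → ℂ} (hhh : Summable fun i => h i * (ρ i)⁻¹ * h i)
    (hhk : Summable fun i => h i * (ρ i)⁻¹ * k i) (hkk : Summable fun i => k i * (ρ i)⁻¹ * k i)
    (a b : ℂ) :
    fisherRao ρ (fun i => a * h i + b * k i) (fun i => a * h i + b * k i) =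
      a ^ 2 * fisherRao ρ h h + 2 * a * b * fisherRao ρ h k + b ^ 2 * fisherRao ρ k k := by
  have hexp : ∀ i, (a * h i + b * k i) * (ρ i)⁻¹ * (a * h i + b * k i) =
      a ^ 2 * (h i * (ρ i)⁻¹ * h i) + 2 * a * b * (h i * (ρ i)⁻¹ * k i) +
        b ^ 2 * (k i * (ρ i)⁻¹ * k i) := fun i => by ring
  simp only [fisherRao, diagTrace, hexp]
  rw [((hhh.mul_left _).add (hhk.mul_left _)).tsum_add (hkk.mul_left _),
    (hhh.mul_left _).tsum_add (hhk.mul_left _), tsum_mul_left, tsum_mul_left, tsum_mul_left]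
  ring

/-- The Fisher--Rao tensor is the quadratic term of the Kullback--Leibler divergence, for
increments dominated by the distribution. -/
theorem klDiv_expansion {ρ h k : ι → ℂ} {C : ℝ} (hsum : Summable ρ) (hρ : ∀ i, ρ i ≠ 0)
    (hh : ∀ i, ‖h i‖ ≤ C * ‖ρ i‖) (hk : ∀ i, ‖k i‖ ≤ C * ‖ρ i‖) :
    (∀ᶠ c : ℂ × ℂ in 𝓝 0, Summable (klTerm (fun i => ρ i + (c.1 * h i + c.2 * k i)) ρ)) ∧
      (fun c : ℂ × ℂ =>
        klDiv (fun i => ρ i + (c.1 * h i + c.2 * k i)) ρ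
          - (c.1 * diagTrace h + c.2 * diagTrace k)
          - (c.1 ^ 2 * fisherRao ρ h h + 2 * c.1 * c.2 * fisherRao ρ h k
            + c.2 ^ 2 * fisherRao ρ k k))
        =O[𝓝 0] fun c : ℂ × ℂ => ‖c‖ ^ 3 := by
  -- The relative size is `r = 2 C ‖c‖`: two terms, each coefficient bounded by the sup norm of `c`.
  have hbound : ∀ (c : ℂ × ℂ) (i : ι), ‖c.1 * h i + c.2 * k i‖ ≤ 2 * C * ‖c‖ * ‖ρ i‖ := by
    intro c i
    calc ‖c.1 * h i + c.2 * k i‖ ≤ ‖c.1‖ * ‖h i‖ + ‖c.2‖ * ‖k i‖ := by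
          simpa only [norm_mul] using norm_add_le (c.1 * h i) (c.2 * k i)
      _ ≤ ‖c‖ * (C * ‖ρ i‖) + ‖c‖ * (C * ‖ρ i‖) := by
          gcongr
          exacts [norm_fst_le c, hh i, norm_snd_le c, hk i]
      _ = 2 * C * ‖c‖ * ‖ρ i‖ := by ring
  have hsmall : ∀ᶠ c : ℂ × ℂ in 𝓝 0, 2 * C * ‖c‖ ≤ 1 / 2 := by
    have hcont : Tendsto (fun c : ℂ × ℂ => 2 * C * ‖c‖) (𝓝 0) (𝓝 0) :=
      Continuous.tendsto' (by fun_prop) _ _ (by simp)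
    exact hcont.eventually_le_const (by norm_num)
  refine ⟨hsmall.mono fun c hc => summable_klTerm_add hsum hρ hc (hbound c),
    IsBigO.of_bound (2 * (2 * C) ^ 3 * ∑' i, ‖ρ i‖) (hsmall.mono fun c hc => ?_)⟩
  rw [← diagTrace_add_mul (summable_of_norm_le_mul hsum hh) (summable_of_norm_le_mul hsum hk),
    ← fisherRao_add_mul (summable_mul_inv_mul hsum hh hh) (summable_mul_inv_mul hsum hh hk)
      (summable_mul_inv_mul hsum hk hk)]
  refine (norm_klDiv_add_sub_le hsum hρ hc (hbound c)).trans_eq ?_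
  rw [norm_pow, norm_norm]
  ring

end Divergence

end ArcFisher

open ArcFisher in
theorem proposition6p7p2 {K : Type u} [Field K] [Finite K]
    (X : Over (base K)) [IsSeparated X.hom] [LocallyOfFiniteType X.hom] [QuasiCompact X.hom]
    (f : X ⟶ affineLine K) (χ χ' : AddChar K ℂ) (t : ℂ) (ht : t ≠ 0)
    (hconv : Summable fun p : Index X => χ (value f p) * t ^ p.1)
    (hzeta : zeta χ f t ≠ 0)
    (v w : TangentField X) :
    let ρ : Index X → ℂ := zetaDist χ f t
    let h : TangentField X → Index X → ℂ := incrementAlong (pairChar χ χ') f t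
    let g : TangentField X → TangentField X → ℂ := fun a b => fisherRao ρ (h a) (h b)
    -- the closed formula for the tensor, with convergence of the two sums
    (Summable (fun p : Index X => h v p * (ρ p)⁻¹ * h w p) ∧
      Summable (fun p : Index X =>
        χ (value f p) * χ' (differential (symPower.map f p.1) (v p)) *
          χ' (differential (symPower.map f p.1) (w p)) * t ^ p.1) ∧
      g v w = zeta χ f t / 2 * ∑' p : Index X,
        χ (value f p) * χ' (differential (symPower.map f p.1) (v p)) *
          χ' (differential (symPower.map f p.1) (w p)) * t ^ p.1) ∧
    -- it is the quadratic term of the divergence from `ρ` of the distribution `ρ + h`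
    (Summable (h v) ∧ Summable (h w) ∧
      (∀ᶠ c : ℂ × ℂ in 𝓝 0,
        Summable (klTerm (fun p => ρ p + (c.1 * h v p + c.2 * h w p)) ρ)) ∧
      (fun c : ℂ × ℂ =>
        klDiv (fun p => ρ p + (c.1 * h v p + c.2 * h w p)) ρ
          - (c.1 * diagTrace (h v) + c.2 * diagTrace (h w))
          - (c.1 ^ 2 * g v v + 2 * c.1 * c.2 * g v w + c.2 ^ 2 * g w w))
        =O[𝓝 0] fun c : ℂ × ℂ => ‖c‖ ^ 3) := by
  intro ρ h g
  have hρ : ∀ p, ρ p ≠ 0 := fun p =>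
    div_ne_zero (mul_ne_zero (χ.val_isUnit _).ne_zero (pow_ne_zero _ ht)) hzeta
  have hsum : Summable ρ := hconv.div_const _
  have hval : ∀ a p, h a p =
      zeta χ f t * χ' (differential (symPower.map f p.1) (a p)) * ρ p := by
    intro a p
    simp only [h, ρ, zetaDist, incrementAlong_pairChar]
    field_simp
  have hh : ∀ a p, ‖h a p‖ ≤ ‖zeta χ f t‖ * ‖ρ p‖ := fun a p => by
    rw [hval, norm_mul, norm_mul, AddChar.norm_apply, mul_one]
  -- Two factors `ζ` come from the increments; one is absorbed in turning the remaining `ρ p` back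
  -- into `χ(f) tⁿ`.
  have hterm : ∀ p, h v p * (ρ p)⁻¹ * h w p = zeta χ f t *
      (χ (value f p) * χ' (differential (symPower.map f p.1) (v p)) *
        χ' (differential (symPower.map f p.1) (w p)) * t ^ p.1) := by
    intro p
    have hdist : χ (value f p) * t ^ p.1 = zeta χ f t * ρ p := (mul_div_cancel₀ _ hzeta).symm
    rw [hval, hval, mul_right_comm _ _ (t ^ p.1), mul_right_comm _ _ (t ^ p.1), hdist]
    field_simp [hρ p]
  have hg := summable_mul_inv_mul hsum (hh v) (hh w)
  refine ⟨⟨hg, ?_, ?_⟩, summable_of_norm_le_mul hsum (hh v), summable_of_norm_le_mul hsum (hh w),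
    klDiv_expansion hsum hρ (hh v) (hh w)⟩
  -- As `ζ ≠ 0`, convergence passes from the trace series to the character series.
  · exact (summable_mul_left_iff hzeta).1 (hg.congr fun p => (hterm p))
  · simp only [g, fisherRao, diagTrace, hterm]
    rw [tsum_mul_left]
    ring
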